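/- **Setting.** Let $n_x,n_y,n_L,N\ge 1$ and $n_u,n_v,n_w\ge 0$ be integers, let $\mathcal U\subseteq\mathbb R^{n_u}$, $\mathcal V\subseteq\mathbb R^{n_v}$, $\mathcal W\subseteq\mathbb R^{n_w}$ be closed, and let $\mathcal L_{\mathcal S}$ denote the Lebesgue measurable, locally essentially bounded functions $[0,\infty)\to\mathcal S$. Consider the plant $\dot x=f_p(x,u,v)$, $y=h(x,w)$ with $x\in\mathbb R^{n_x}$, $y\in\mathbb R^{n_y}$, and $N+1$ modes $$\dot{\hat x}_k=f_o(\hat x_k,u,L_k(y-\hat y_k)),\qquad \hat y_k=h(\hat x_k,0),\qquad L_k\in\mathbb R^{n_L\times n_y},\quad k=1,\dots,N+1,$$ mode $1$ being the nominal observer, with monitoring variables $\eta_k\ge 0$, $$\dot\eta_k=g_k:=-\nu\eta_k+(y-\hat y_k)^\top(\Lambda_1+L_k^\top\Lambda_2L_k)(y-\hat y_k),$$ where $\Lambda_1\in\mathbb R^{n_y\times n_y}$ and $\Lambda_2\in\mathbb R^{n_L\times n_L}$ are symmetric positive semidefinite, at least one of them positive definite, and $\nu\in(0,\alpha]$ with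 $\alpha$ from Assumption 1. The state of the hybrid system is $q=(x,\hat x_1,\dots,\hat x_{N+1},\eta_1,\dots,\eta_{N+1},\sigma)$ with $\eta_k\ge 0$ and $\sigma\in\{1,\dots,N+1\}$. It flows, with $\sigma$ constant and the above dynamics, in $\mathcal C=\{q:\eta_k\ge\eta_\sigma\ \forall k\}$. It may jump in $\mathcal D=\{q:\exists k\ne\sigma,\ \eta_k\le\eta_\sigma\}$. Let $\Pi=\operatorname{argmin}_{k\ne\sigma}\eta_k$, $K=\operatorname{argmin}_{k\in\Pi}g_k$, let $\varepsilon>0$, and let $r\in\{0,1\}$ (without/with resets) be fixed. At a jump, $x^+=x$, $\hat x_1^+=\hat x_1$, $\eta_1^+=\eta_1$, $\sigma^+\in K$ and, for $k\ge 2$, $\hat x_k^+\in\{(1-r)\hat x_k+r\hat x_{k^\star}:k^\star\in K\}$, while $$\eta_k^+=\eta_k\ \text{ if } k=\sigma^+,\qquad \eta_k^+=(1-r)\eta_k+r\min_{i\ne\sigma}\eta_i+\varepsilon\ \text{ if } k\neq\sigma^+.$$ Solutions are hybrid arcs, defined on hybrid time domains $\operatorname{dom}q\subseteq[0,\infty)\times\mathbb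 Z_{\ge 0}$, locally absolutely continuous between jumps and satisfying the flow equations almost everywhere; a solution is maximal if it has no proper extension. **Assumption 1.** There are $\underline\alpha,\overline\alpha,\psi_1,\psi_2\in\mathcal K_\infty$, $\alpha>0$, $\gamma\ge 0$ and a continuously differentiable $V:\mathbb R^{n_x}\to[0,\infty)$ such that for all $x,e\in\mathbb R^{n_x}$, $d\in\mathbb R^{n_L}$, $u\in\mathcal U$, $v\in\mathcal V$, $w\in\mathcal W$: $\underline\alpha(|e|)\le V(e)\le\overline\alpha(|e|)$ and $$\big\langle\nabla V(e),\ f_p(x,u,v)-f_o\big(x-e,u,L_1(h(x,w)-h(x-e,0))+d\big)\big\rangle\le-\alpha V(e)+\psi_1(|v|)+\psi_2(|w|)+\gamma|d|^2.$$ **Assumption 2.** There are $\delta_1,\delta_2>0$ such that $|h(x,w)-h(x',w')|^2\le\delta_1V(x-x')+\delta_2|w-w'|^2$ for all $x,x'\in\mathbb R^{n_x}$ and $w,w'\in\mathcal W$. **Assumption 3.** Every maximal solution of the plant with $u\in\mathcal L_{\mathcal U}$, $v\in\mathcal L_{\mathcal V}$, $w\in\mathcal L_{\mathcal W}$ is complete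 (has an unbounded domain). **Costs.** For $(t,j)\in\operatorname{dom}q$ let $0=t_0\le t_1\le\dots\le t_{j+1}=t$ be the times with $\operatorname{dom}q\cap([0,t]\times\{0,\dots,j\})=\bigcup_{i=0}^j[t_i,t_{i+1}]\times\{i\}$, and put $$J_\sigma(t,j)=\sum_{i=0}^{j}\int_{t_i}^{t_{i+1}}\eta_{\sigma(s,i)}(s,i)\,ds,\qquad J_1(t,j)=\sum_{i=0}^{j}\int_{t_i}^{t_{i+1}}\eta_1(s,i)\,ds .$$ **Theorem.** Suppose Assumptions 1–3 hold, and let $q$ be a maximal solution of the hybrid system with inputs $u\in\mathcal L_{\mathcal U}$, $v\in\mathcal L_{\mathcal V}$, $w\in\mathcal L_{\mathcal W}$ such that, for some $\eta_0\in\mathbb R$, $\eta_k(0,0)=\eta_0$ for all $k\in\{1,\dots,N+1\}$. Then $J_\sigma(t,j)\le J_1(t,j)$ for all $(t,j)\in\operatorname{dom}q$. Moreover, if there is $(t^\star,j^\star)\in\operatorname{dom}q$ with $\eta_{\sigma(t^\star,j^\star)}(t^\star,j^\star)<\eta_1(t^\star,j^\star)$, then there is $j^{\star\prime}\ge j^\star$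 with $(t^\star,j^{\star\prime})\in\operatorname{dom}q$ such that $J_\sigma(t,j)<J_1(t,j)$ for all $(t,j)\in\operatorname{dom}q$ with $t\ge t^\star$ and $j\ge j^{\star\prime}$. -/

import Mathlib

open Set Filter Topology MeasureTheory
open scoped NNReal

noncomputable section

namespace HybridMultiObserver

/-- `ℝⁿ` with the Euclidean norm. -/
abbrev Vec (n : ℕ) : Type := EuclideanSpace ℝ (Fin n)

/-! ### Comparison functions, input signals, absolute continuity -/

/-- Class `𝒦_∞`. -/
structure IsClassKInfty (a : ℝ≥0 → ℝ≥0) : Prop where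
  continuous : Continuous a
  map_zero : a 0 = 0
  strictMono : StrictMono a
  tendsto : Tendsto a atTop atTop

/-- `ℒ_S`: the Lebesgue measurable, locally essentially bounded functions from `[0, ∞)` to `S`
(the values of `f` at negative times play no role). -/
structure IsInput {n : ℕ} (S : Set (Vec n)) (f : ℝ → Vec n) : Prop where
  mem : ∀ t, 0 ≤ t → f t ∈ S
  measurable : AEMeasurable f (volume.restrict (Ici 0))
  locallyBounded : ∀ T : ℝ, ∃ M : ℝ, ∀ᵐ t ∂(volume.restrict (Icc 0 T)), ‖f t‖ ≤ M

/-- `f` is absolutely continuous on every compact subinterval of `I`. -/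
def LocallyAC {X : Type*} [PseudoMetricSpace X] (f : ℝ → X) (I : Set ℝ) : Prop :=
  ∀ a b : ℝ, a ≤ b → Icc a b ⊆ I → AbsolutelyContinuousOnInterval f a b

/-! ### Data of the plant and of the estimation scheme -/

/-- The plant `ẋ = f_p(x, u, v)`, `y = h(x, w)`, the observer map `f_o`, and the design data of the
hybrid multi-observer with `N + 1` modes. The modes `1, …, N + 1` are indexed by `Fin (N + 1)`;
the nominal mode `1` is the index `0`. -/
structure Scheme (nx nu nv nw ny nL N : ℕ) where
  /-- values of the measured input -/
  U : Set (Vec nu)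
  /-- values of the disturbance input -/
  V : Set (Vec nv)
  /-- values of the measurement noise -/
  W : Set (Vec nw)
  isClosed_U : IsClosed U
  isClosed_V : IsClosed V
  isClosed_W : IsClosed W
  /-- plant vector field -/
  fp : Vec nx → Vec nu → Vec nv → Vec nx
  /-- output map -/
  h : Vec nx → Vec nw → Vec ny
  /-- observer vector field -/
  fo : Vec nx → Vec nu → Vec nL → Vec nx
  /-- output injection gains of the modes -/
  L : Fin (N + 1) → Matrix (Fin nL) (Fin ny) ℝ
  /-- weight of the output estimation error -/
  Λ₁ : Matrix (Fin ny) (Fin ny) ℝ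
  /-- weight of the correction effort -/
  Λ₂ : Matrix (Fin nL) (Fin nL) ℝ
  posSemidef_Λ₁ : Λ₁.PosSemidef
  posSemidef_Λ₂ : Λ₂.PosSemidef
  posDef_or : Λ₁.PosDef ∨ Λ₂.PosDef
  /-- discount rate of the monitoring variables -/
  ν : ℝ
  ν_pos : 0 < ν
  /-- penalty of the unselected modes at a switch -/
  ε : ℝ
  ε_pos : 0 < ε
  /-- `0`: without resets, `1`: with resets -/
  r : ℝ
  r_eq : r = 0 ∨ r = 1

/-- Overall state `q = (x, x̂_1, …, x̂_{N+1}, η_1, …, η_{N+1}, σ)`; the constraint `η_k ≥ 0` of the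
state space `𝒬` is imposed in `stateSpace`. -/
structure State (nx N : ℕ) where
  x : Vec nx
  xhat : Fin (N + 1) → Vec nx
  η : Fin (N + 1) → ℝ
  σ : Fin (N + 1)

/-- `𝒬 = ℝ^{n_x} × ℝ^{(N+1) n_x} × ℝ_{≥0}^{N+1} × {1, …, N+1}`. -/
def stateSpace (nx N : ℕ) : Set (State nx N) := {q | ∀ k, 0 ≤ q.η k}

/-- The elements of `s` that minimize `f` over `s`. -/
def argminOn {ι : Type*} (s : Set ι) (f : ι → ℝ) : Set ι := {k ∈ s | IsMinOn f s k}

/-! ### Hybrid time domains -/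

/-- `0 = t_0 ≤ t_1 ≤ … ≤ t_{j+1} = t` and
`E ∩ ([0, t] × {0, …, j}) = ⋃_{i ≤ j} [t_i, t_{i+1}] × {i}` (with `t_i = τ i`). -/
structure IsTimePartition (E : Set (ℝ × ℕ)) (t : ℝ) (j : ℕ) (τ : ℕ → ℝ) : Prop where
  zero : τ 0 = 0
  le_succ : ∀ i ≤ j, τ i ≤ τ (i + 1)
  last : τ (j + 1) = t
  inter_eq : E ∩ (Icc 0 t ×ˢ Iic j) = ⋃ i ∈ Iic j, Icc (τ i) (τ (i + 1)) ×ˢ {i}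

/-- Hybrid time domains: subsets of `[0, ∞) × ℕ` containing `(0, 0)` all of whose truncations
`E ∩ ([0, t] × {0, …, j})`, `(t, j) ∈ E`, are compact hybrid time domains. -/
structure IsHybridTimeDomain (E : Set (ℝ × ℕ)) : Prop where
  zero_mem : ((0 : ℝ), 0) ∈ E
  nonneg : ∀ p ∈ E, 0 ≤ p.1
  partition : ∀ p ∈ E, ∃ τ : ℕ → ℝ, IsTimePartition E p.1 p.2 τ

/-- `I^j = {t : (t, j) ∈ E}`. -/
def flowInterval (E : Set (ℝ × ℕ)) (j : ℕ) : Set ℝ := {t | (t, j) ∈ E}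

/-- The times `t_0, …, t_{j+1}` of the truncation of `E` at `(t, j)`. For `(t, j)` in a hybrid time
domain `E` they exist, and `t_0, …, t_{j+1}` are uniquely determined. -/
def switchTimes (E : Set (ℝ × ℕ)) (t : ℝ) (j : ℕ) : ℕ → ℝ :=
  Classical.epsilon fun τ => IsTimePartition E t j τ

namespace Scheme

variable {nx nu nv nw ny nL N : ℕ} (S : Scheme nx nu nv nw ny nL N)

/-! ### The assumptions -/

/-- Perturbed error dynamics of the nominal observer,
`f_p(x, u, v) - f_o(x̂_1, u, L_1 (y - ŷ_1) + d)` with `x̂_1 = x - e`, `y = h(x, w)`,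
`ŷ_1 = h(x̂_1, 0)`. -/
def errorField (e x : Vec nx) (u : Vec nu) (v : Vec nv) (w : Vec nw) (d : Vec nL) : Vec nx :=
  S.fp x u v - S.fo (x - e) u ((S.L 0).toEuclideanLin (S.h x w - S.h (x - e) 0) + d)

/-- Input-to-state stability of the perturbed nominal error dynamics, with Lyapunov function `Vf` and
decay rate `α`. -/
def NominalAssumption (α : ℝ) (Vf : Vec nx → ℝ) : Prop :=
  0 < α ∧ (∀ e, 0 ≤ Vf e) ∧ ContDiff ℝ 1 Vf ∧
  ∃ (αlow αup ψ₁ ψ₂ : ℝ≥0 → ℝ≥0) (γ : ℝ),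
    IsClassKInfty αlow ∧ IsClassKInfty αup ∧ IsClassKInfty ψ₁ ∧ IsClassKInfty ψ₂ ∧ 0 ≤ γ ∧
    ∀ (x e : Vec nx) (d : Vec nL), ∀ u ∈ S.U, ∀ v ∈ S.V, ∀ w ∈ S.W,
      ((αlow ‖e‖₊ : ℝ) ≤ Vf e ∧ Vf e ≤ (αup ‖e‖₊ : ℝ)) ∧
      inner ℝ (gradient Vf e) (S.errorField e x u v w d)
        ≤ -α * Vf e + (ψ₁ ‖v‖₊ : ℝ) + (ψ₂ ‖w‖₊ : ℝ) + γ * ‖d‖ ^ 2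

/-- The assumption on the output map, `Vf` being the Lyapunov function of `NominalAssumption`. -/
def OutputAssumption (Vf : Vec nx → ℝ) : Prop :=
  ∃ δ₁ δ₂ : ℝ, 0 < δ₁ ∧ 0 < δ₂ ∧
    ∀ (x x' : Vec nx), ∀ w ∈ S.W, ∀ w' ∈ S.W,
      ‖S.h x w - S.h x' w'‖ ^ 2 ≤ δ₁ * Vf (x - x') + δ₂ * ‖w - w'‖ ^ 2

/-- `x` is a (Carathéodory) solution of `ẋ = f_p(x, u, v)` on the nondegenerate interval `I` that
starts at time `0`. -/
structure IsPlantSolution (u : ℝ → Vec nu) (v : ℝ → Vec nv) (I : Set ℝ) (x : ℝ → Vec nx) :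
    Prop where
  zero_mem : (0 : ℝ) ∈ I
  nonneg : I ⊆ Ici 0
  ordConnected : I.OrdConnected
  nontrivial : I.Nontrivial
  ac : LocallyAC x I
  deriv : ∀ᵐ t ∂(volume.restrict I), HasDerivWithinAt x (S.fp (x t) (u t) (v t)) I t

/-- A plant solution that has no proper extension. -/
def IsMaximalPlantSolution (u : ℝ → Vec nu) (v : ℝ → Vec nv) (I : Set ℝ) (x : ℝ → Vec nx) :
    Prop :=
  S.IsPlantSolution u v I x ∧
    ∀ (I' : Set ℝ) (x' : ℝ → Vec nx), S.IsPlantSolution u v I' x' → I ⊆ I' → EqOn x' x I → I' = I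

/-- Any maximal solution of the plant is complete, i.e. has an unbounded domain. -/
def CompletenessAssumption : Prop :=
  ∀ (u : ℝ → Vec nu) (v : ℝ → Vec nv) (w : ℝ → Vec nw),
    IsInput S.U u → IsInput S.V v → IsInput S.W w →
    ∀ (I : Set ℝ) (x : ℝ → Vec nx), S.IsMaximalPlantSolution u v I x → ¬ BddAbove I

/-! ### The hybrid system -/

/-- `y - ŷ_k`, with `y = h(x, w)` and `ŷ_k = h(x̂_k, 0)`. -/
def outputError (q : State nx N) (w : Vec nw) (k : Fin (N + 1)) : Vec ny :=
  S.h q.x w - S.h (q.xhat k) 0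

/-- Right-hand side of the dynamics of `x̂_k`: `f_o(x̂_k, u, L_k (y - ŷ_k))`. -/
def observerField (q : State nx N) (u : Vec nu) (w : Vec nw) (k : Fin (N + 1)) : Vec nx :=
  S.fo (q.xhat k) u ((S.L k).toEuclideanLin (S.outputError q w k))

/-- Right-hand side of the dynamics of `η_k`:
`g_k = -ν η_k + (y - ŷ_k)ᵀ (Λ₁ + L_kᵀ Λ₂ L_k) (y - ŷ_k)`. -/
def monitorField (q : State nx N) (w : Vec nw) (k : Fin (N + 1)) : ℝ :=
  -S.ν * q.η k +
    inner ℝ (S.outputError q w k)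
      ((S.Λ₁ + (S.L k).transpose * S.Λ₂ * S.L k).toEuclideanLin (S.outputError q w k))

/-- Flow set `𝒞`. -/
def flowSet (_S : Scheme nx nu nv nw ny nL N) : Set (State nx N) :=
  {q ∈ stateSpace nx N | ∀ k, q.η q.σ ≤ q.η k}

/-- Jump set `𝒟`. -/
def jumpSet (_S : Scheme nx nu nv nw ny nL N) : Set (State nx N) :=
  {q ∈ stateSpace nx N | ∃ k, k ≠ q.σ ∧ q.η k ≤ q.η q.σ}

/-- The modes that may be selected at a switch: among the modes `k ≠ σ` with minimal `η_k` (the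
set `Π`), those with minimal `g_k`. -/
def candidates (q : State nx N) (w : Vec nw) : Set (Fin (N + 1)) :=
  argminOn (argminOn {k | k ≠ q.σ} q.η) (S.monitorField q w)

/-- `q⁺ ∈ G(q)`, with `w` the value of the noise in `y = h(x, w)`. The mode that is
not penalized by `ε` is the newly selected mode `σ⁺`. -/
structure IsJump (w : Vec nw) (q q' : State nx N) : Prop where
  x_eq : q'.x = q.x
  xhat_nominal : q'.xhat 0 = q.xhat 0
  xhat_eq : ∀ k, k ≠ 0 →
    ∃ kstar ∈ S.candidates q w, q'.xhat k = (1 - S.r) • q.xhat k + S.r • q.xhat kstar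
  η_nominal : q'.η 0 = q.η 0
  η_selected : ∀ k, k ≠ 0 → k = q'.σ → q'.η k = q.η k
  η_unselected : ∀ k, k ≠ 0 → k ≠ q'.σ →
    q'.η k = (1 - S.r) * q.η k + S.r * (⨅ i : {i : Fin (N + 1) // i ≠ q.σ}, q.η i) + S.ε
  σ_mem : q'.σ ∈ S.candidates q w

/-- The hybrid arc `q` with domain `E` is a solution of the hybrid system for the inputs
`u, v, w` (the values of `q` outside `E` play no role). -/
structure IsSolution (u : ℝ → Vec nu) (v : ℝ → Vec nv) (w : ℝ → Vec nw)
    (E : Set (ℝ × ℕ)) (q : ℝ → ℕ → State nx N) : Prop where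
  isHybridTimeDomain : IsHybridTimeDomain E
  init : q 0 0 ∈ S.flowSet ∪ S.jumpSet
  ac_x : ∀ j, LocallyAC (fun t => (q t j).x) (flowInterval E j)
  ac_xhat : ∀ j k, LocallyAC (fun t => (q t j).xhat k) (flowInterval E j)
  ac_η : ∀ j k, LocallyAC (fun t => (q t j).η k) (flowInterval E j)
  ac_σ : ∀ j, LocallyAC (fun t => (((q t j).σ : ℕ) : ℝ)) (flowInterval E j)
  mem_flowSet : ∀ j, ∀ᵐ t ∂(volume.restrict (flowInterval E j)), q t j ∈ S.flowSet
  flow_x : ∀ j, ∀ᵐ t ∂(volume.restrict (flowInterval E j)),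
    HasDerivWithinAt (fun s => (q s j).x) (S.fp (q t j).x (u t) (v t)) (flowInterval E j) t
  flow_xhat : ∀ j k, ∀ᵐ t ∂(volume.restrict (flowInterval E j)),
    HasDerivWithinAt (fun s => (q s j).xhat k) (S.observerField (q t j) (u t) (w t) k)
      (flowInterval E j) t
  flow_η : ∀ j k, ∀ᵐ t ∂(volume.restrict (flowInterval E j)),
    HasDerivWithinAt (fun s => (q s j).η k) (S.monitorField (q t j) (w t) k)
      (flowInterval E j) t
  flow_σ : ∀ j, ∀ᵐ t ∂(volume.restrict (flowInterval E j)),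
    HasDerivWithinAt (fun s => (((q s j).σ : ℕ) : ℝ)) 0 (flowInterval E j) t
  jump : ∀ t j, (t, j) ∈ E → (t, j + 1) ∈ E →
    q t j ∈ S.jumpSet ∧ S.IsJump (w t) (q t j) (q t (j + 1))

/-- A solution that has no proper extension for the same inputs. -/
def IsMaximalSolution (u : ℝ → Vec nu) (v : ℝ → Vec nv) (w : ℝ → Vec nw)
    (E : Set (ℝ × ℕ)) (q : ℝ → ℕ → State nx N) : Prop :=
  S.IsSolution u v w E q ∧
    ∀ (E' : Set (ℝ × ℕ)) (q' : ℝ → ℕ → State nx N), S.IsSolution u v w E' q' → E ⊆ E' →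
      (∀ t j, (t, j) ∈ E → q' t j = q t j) → E' = E

end Scheme

/-! ### The costs -/

/-- `J_σ(t, j) = ∑_{i=0}^{j} ∫_{t_i}^{t_{i+1}} η_{σ(s,i)}(s, i) ds`. -/
def costSelected {nx N : ℕ} (E : Set (ℝ × ℕ)) (q : ℝ → ℕ → State nx N) (t : ℝ) (j : ℕ) : ℝ :=
  ∑ i ∈ Finset.range (j + 1),
    ∫ s in (switchTimes E t j i)..(switchTimes E t j (i + 1)), (q s i).η (q s i).σ

/-- `J_1(t, j) = ∑_{i=0}^{j} ∫_{t_i}^{t_{i+1}} η_1(s, i) ds`. -/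
def costNominal {nx N : ℕ} (E : Set (ℝ × ℕ)) (q : ℝ → ℕ → State nx N) (t : ℝ) (j : ℕ) : ℝ :=
  ∑ i ∈ Finset.range (j + 1),
    ∫ s in (switchTimes E t j i)..(switchTimes E t j (i + 1)), (q s i).η 0

end HybridMultiObserver

end

namespace HybridMultiObserver

/-! On a flow interval of positive length the state lies in the flow set for almost every time, and
continuity upgrades this to `η_σ ≤ η_k` at every time. Degenerate intervals contribute nothing to
the costs, so the weak inequality follows by integrating and summing over intervals.

For the strict part, a strict gap at one point of a nondegenerate interval makes its integral
strictly smaller, by continuity. The difficulty is that `(tstar, jstar)` may lie between two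
simultaneous jumps, where the interval is a single point. But jumps cannot create a gap: they leave
`η_1` alone and never push another monitor below it when `η_1` is minimal (`IsJump.nominal_le`).
Tracing back through the jumps at time `tstar`, the gap was already present at the end of a
nondegenerate flow interval (`exists_flow_lt`). At time `0` there may be no such interval, but there
the equal initial values make `η_1` minimal and rule a gap out. -/

theorem le_on_Icc_of_ae_le {f g : ℝ → ℝ} {a b : ℝ} (hab : a < b)
    (hf : ContinuousOn f (Icc a b)) (hg : ContinuousOn g (Icc a b))
    (h : ∀ᵐ t ∂(volume.restrict (Icc a b)), f t ≤ g t) {t : ℝ} (ht : t ∈ Icc a b) :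
    f t ≤ g t := by
  -- Rewriting `f ≤ g` as `max f g = g` reduces the claim to uniqueness of continuous functions up
  -- to null sets.
  have hmax : EqOn (fun s => max (f s) (g s)) g (Icc a b) :=
    Measure.eqOn_Icc_of_ae_eq volume hab.ne
      (h.mono fun _ hs => max_eq_right hs) (hf.sup hg) hg
  exact max_eq_right_iff.mp (hmax ht)

theorem LocallyAC.continuousOn_Icc {X : Type*} [SeminormedAddCommGroup X] {f : ℝ → X} {I : Set ℝ}
    (hf : LocallyAC f I) {a b : ℝ} (hab : a ≤ b) (hI : Icc a b ⊆ I) : ContinuousOn f (Icc a b) := by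
  rw [← uIcc_of_le hab]
  exact (hf a b hab hI).continuousOn

/-! ### Partitions of hybrid time domains -/

namespace IsTimePartition

variable {E : Set (ℝ × ℕ)} {t : ℝ} {j : ℕ} {τ : ℕ → ℝ}

/-- The pieces of the partition carry distinct second coordinates, so slicing at level `i` isolates
one of them. Hence truncating at a later point can only enlarge the `i`-th interval. -/
theorem Icc_eq (h : IsTimePartition E t j τ) {i : ℕ} (hi : i ≤ j) :
    Icc (τ i) (τ (i + 1)) = flowInterval E i ∩ Icc 0 t := by
  ext s
  have := Set.ext_iff.mp h.inter_eq (s, i)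
  simp only [mem_inter_iff, mem_prod, mem_Iic, mem_iUnion, mem_singleton_iff, exists_prop] at this
  constructor
  · intro hs
    obtain ⟨hE, ht, -⟩ := this.mpr ⟨i, hi, hs, rfl⟩
    exact ⟨hE, ht⟩
  · rintro ⟨hE, ht⟩
    obtain ⟨i', -, hs, rfl⟩ := this.mp ⟨hE, ht, hi⟩
    exact hs

theorem Icc_subset (h : IsTimePartition E t j τ) {i : ℕ} (hi : i ≤ j) :
    Icc (τ i) (τ (i + 1)) ⊆ flowInterval E i :=
  h.Icc_eq hi ▸ inter_subset_left

theorem le_last (h : IsTimePartition E t j τ) {i : ℕ} (hi : i ≤ j) : τ (i + 1) ≤ t := by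
  have hmem := right_mem_Icc.mpr (h.le_succ i hi)
  rw [h.Icc_eq hi] at hmem
  exact hmem.2.2

/-- After the first time at which the partition reaches `t`, it stays at `t`. -/
theorem mem_of_reached (h : IsTimePartition E t j τ) {i : ℕ} (hi : τ (i + 1) = t) {k : ℕ}
    (hik : i ≤ k) (hkj : k ≤ j) : τ (k + 1) = t ∧ (t, k) ∈ E := by
  have hlast : ∀ k, i ≤ k → k ≤ j → τ (k + 1) = t := by
    intro k hik
    induction k, hik using Nat.le_induction with
    | base => exact fun _ => hi
    | succ k _ ih =>
      intro hkj
      exact le_antisymm (h.le_last hkj) ((ih (by omega)).ge.trans (h.le_succ _ hkj))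
  refine ⟨hlast k hik hkj, ?_⟩
  have hmem := h.Icc_subset hkj (right_mem_Icc.mpr (h.le_succ k hkj))
  rwa [hlast k hik hkj] at hmem

/-- A positive time `t` is reached at the end of a nondegenerate interval of the partition. -/
theorem exists_reached (h : IsTimePartition E t j τ) (ht : 0 < t) :
    ∃ i ≤ j, τ i < t ∧ τ (i + 1) = t := by
  classical
  have hex : ∃ i, τ (i + 1) = t := ⟨j, h.last⟩
  have hle : Nat.find hex ≤ j := Nat.find_min' hex h.last
  refine ⟨Nat.find hex, hle, ?_, Nat.find_spec hex⟩
  have hτ : τ (Nat.find hex) ≤ t := (h.le_succ _ hle).trans (Nat.find_spec hex).le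
  refine lt_of_le_of_ne hτ fun heq => ?_
  -- If the first interval ending at `t` also began at `t`, then either `t = τ 0 = 0` or the
  -- preceding interval already ended at `t`.
  rcases hn : Nat.find hex with _ | m
  · rw [hn, h.zero] at heq
    exact ht.ne heq
  · rw [hn] at heq
    exact Nat.find_min hex (by omega) heq

end IsTimePartition

theorem IsHybridTimeDomain.isTimePartition_switchTimes {E : Set (ℝ × ℕ)}
    (hE : IsHybridTimeDomain E) {t : ℝ} {j : ℕ} (h : (t, j) ∈ E) :
    IsTimePartition E t j (switchTimes E t j) :=
  Classical.epsilon_spec (hE.partition _ h)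

/-! ### Jumps, flows and cost comparison -/

namespace Scheme

variable {nx nu nv nw ny nL N : ℕ} {S : Scheme nx nu nv nw ny nL N}

/-- Jumps preserve the property that the nominal monitoring variable is the smallest one. -/
theorem IsJump.nominal_le {w : Vec nw} {q q' : State nx N} (hJ : S.IsJump w q q')
    (h : ∀ k, q.η 0 ≤ q.η k) (k : Fin (N + 1)) : q'.η 0 ≤ q'.η k := by
  rw [hJ.η_nominal]
  by_cases hk : k = 0
  · rw [hk, hJ.η_nominal]
  by_cases hσ : k = q'.σ
  · rw [hJ.η_selected k hk hσ]
    exact h k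
  rw [hJ.η_unselected k hk hσ]
  -- The newly selected mode differs from the old one, so the infimum is over a nonempty set.
  have : Nonempty {i : Fin (N + 1) // i ≠ q.σ} := ⟨⟨q'.σ, hJ.σ_mem.1.1⟩⟩
  have hinf : q.η 0 ≤ ⨅ i : {i : Fin (N + 1) // i ≠ q.σ}, q.η i := le_ciInf fun i => h i
  have hε := S.ε_pos
  have hk := h k
  rcases S.r_eq with hr | hr <;> rw [hr] <;> linarith

namespace IsSolution

variable {u : ℝ → Vec nu} {v : ℝ → Vec nv} {w : ℝ → Vec nw} {E : Set (ℝ × ℕ)}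
  {q : ℝ → ℕ → State nx N}

/-- A continuous integer-valued function on a connected set is constant. -/
theorem σ_eq (hq : S.IsSolution u v w E q) {j : ℕ} {a b : ℝ} (hab : a ≤ b)
    (hI : Icc a b ⊆ flowInterval E j) {s t : ℝ} (hs : s ∈ Icc a b) (ht : t ∈ Icc a b) :
    (q s j).σ = (q t j).σ := by
  have hreal := (hq.ac_σ j).continuousOn_Icc hab hI
  have hnat : ContinuousOn (fun t => ((q t j).σ : ℕ)) (Icc a b) :=
    Nat.isClosedEmbedding_coe_real.isEmbedding.continuousOn_iff.mpr hreal
  exact Fin.ext (isPreconnected_Icc.constant hnat hs ht)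

theorem continuousOn_η (hq : S.IsSolution u v w E q) {j : ℕ} {a b : ℝ} (hab : a ≤ b)
    (hI : Icc a b ⊆ flowInterval E j) (k : Fin (N + 1)) :
    ContinuousOn (fun t => (q t j).η k) (Icc a b) :=
  (hq.ac_η j k).continuousOn_Icc hab hI

theorem continuousOn_η_σ (hq : S.IsSolution u v w E q) {j : ℕ} {a b : ℝ} (hab : a ≤ b)
    (hI : Icc a b ⊆ flowInterval E j) :
    ContinuousOn (fun t => (q t j).η (q t j).σ) (Icc a b) :=
  (hq.continuousOn_η hab hI (q a j).σ).congr fun t ht => by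
    simp only [hq.σ_eq hab hI ht (left_mem_Icc.mpr hab)]

/-- Positive length is essential: on a single point the almost-everywhere flow condition is void. -/
theorem η_σ_le (hq : S.IsSolution u v w E q) {j : ℕ} {a b : ℝ} (hab : a < b)
    (hI : Icc a b ⊆ flowInterval E j) {t : ℝ} (ht : t ∈ Icc a b) (k : Fin (N + 1)) :
    (q t j).η (q t j).σ ≤ (q t j).η k :=
  le_on_Icc_of_ae_le (f := fun t => (q t j).η (q t j).σ) (g := fun t => (q t j).η k) hab
    (hq.continuousOn_η_σ hab.le hI) (hq.continuousOn_η hab.le hI k)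
    ((ae_restrict_of_ae_restrict_of_subset hI (hq.mem_flowSet j)).mono fun _ hs => hs.2 k) ht

theorem integral_η_σ_le (hq : S.IsSolution u v w E q) {j : ℕ} {a b : ℝ} (hab : a ≤ b)
    (hI : Icc a b ⊆ flowInterval E j) :
    ∫ s in a..b, (q s j).η (q s j).σ ≤ ∫ s in a..b, (q s j).η 0 := by
  rcases hab.eq_or_lt with rfl | hlt
  · simp
  · exact intervalIntegral.integral_mono_on hab
      ((hq.continuousOn_η_σ hab hI).intervalIntegrable_of_Icc hab)
      ((hq.continuousOn_η hab hI 0).intervalIntegrable_of_Icc hab)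
      fun s hs => hq.η_σ_le hlt hI hs 0

theorem integral_η_σ_lt (hq : S.IsSolution u v w E q) {j : ℕ} {a b : ℝ} (hab : a < b)
    (hI : Icc a b ⊆ flowInterval E j) {t : ℝ} (ht : t ∈ Icc a b)
    (hlt : (q t j).η (q t j).σ < (q t j).η 0) :
    ∫ s in a..b, (q s j).η (q s j).σ < ∫ s in a..b, (q s j).η 0 :=
  intervalIntegral.integral_lt_integral_of_continuousOn_of_le_of_exists_lt hab
    (hq.continuousOn_η_σ hab.le hI) (hq.continuousOn_η hab.le hI 0)
    (fun _ hs => hq.η_σ_le hab hI (Ioc_subset_Icc_self hs) 0) ⟨t, ht, hlt⟩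

/-- If the nominal monitoring variable is the smallest one at `(t, i)`, it stays so during the
subsequent jumps at time `t`. -/
theorem nominal_le_of_jumps (hq : S.IsSolution u v w E q) {t : ℝ} {i j : ℕ} (hij : i ≤ j)
    (hE : ∀ k, i ≤ k → k ≤ j → (t, k) ∈ E) (h : ∀ l, (q t i).η 0 ≤ (q t i).η l) :
    ∀ l, (q t j).η 0 ≤ (q t j).η l := by
  induction j, hij using Nat.le_induction with
  | base => exact h
  | succ j hij ih =>
    have hjump := hq.jump t j (hE j hij (by omega)) (hE (j + 1) (by omega) le_rfl)
    exact hjump.2.nominal_le (ih fun k hik hkj => hE k hik (by omega))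

theorem costSelected_le (hq : S.IsSolution u v w E q) {t : ℝ} {j : ℕ} (h : (t, j) ∈ E) :
    costSelected E q t j ≤ costNominal E q t j := by
  have hτ := hq.isHybridTimeDomain.isTimePartition_switchTimes h
  refine Finset.sum_le_sum fun i hi => ?_
  have hi' : i ≤ j := Nat.lt_succ_iff.mp (Finset.mem_range.mp hi)
  exact hq.integral_η_σ_le (hτ.le_succ i hi') (hτ.Icc_subset hi')

/-- If the selected monitoring variable is smaller than the nominal one at `(t, j)`, then it was so
already at the end of the last nondegenerate flow interval before `(t, j)`. -/
theorem exists_flow_lt (hq : S.IsSolution u v w E q) (h₀ : ∀ k, (q 0 0).η 0 ≤ (q 0 0).η k)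
    {t : ℝ} {j : ℕ} (h : (t, j) ∈ E) (hlt : (q t j).η (q t j).σ < (q t j).η 0) :
    ∃ i ≤ j, ∃ a, 0 ≤ a ∧ a < t ∧ Icc a t ⊆ flowInterval E i ∧
      (q t i).η (q t i).σ < (q t i).η 0 := by
  obtain ⟨τ, hτ⟩ := hq.isHybridTimeDomain.partition _ h
  dsimp only at hτ
  rcases (hq.isHybridTimeDomain.nonneg _ h).eq_or_lt with ht | ht
  · dsimp only at ht
    subst ht
    -- At `t = 0` every interval is degenerate, so `(0, j)` is reached from `(0, 0)` by jumps alone.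
    have h1 : τ (0 + 1) = 0 :=
      le_antisymm (hτ.le_last j.zero_le) (hτ.zero.ge.trans (hτ.le_succ 0 j.zero_le))
    exact absurd hlt (not_lt.mpr (hq.nominal_le_of_jumps j.zero_le
      (fun k hk hkj => (hτ.mem_of_reached h1 hk hkj).2) h₀ _))
  · obtain ⟨i, hij, hlti, hi⟩ := hτ.exists_reached ht
    have hI := hτ.Icc_subset hij
    have hmem : τ i ∈ Icc (τ i) (τ (i + 1)) := left_mem_Icc.mpr (hτ.le_succ i hij)
    rw [hτ.Icc_eq hij] at hmem
    rw [hi] at hI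
    refine ⟨i, hij, τ i, hmem.2.1, hlti, hI, ?_⟩
    by_contra! hge
    exact absurd hlt (not_lt.mpr (hq.nominal_le_of_jumps hij
      (fun k hk hkj => (hτ.mem_of_reached hi hk hkj).2)
      (fun l => hge.trans (hq.η_σ_le hlti hI (right_mem_Icc.mpr hlti.le) l)) _))

/-- A gap at the end of a nondegenerate flow interval persists in the cost: every later truncation
contains that interval in its `i`-th piece, and the other pieces compare weakly. -/
theorem costSelected_lt (hq : S.IsSolution u v w E q) {t : ℝ} {j : ℕ} (h : (t, j) ∈ E)
    {i : ℕ} (hij : i ≤ j) {a s : ℝ} (ha : 0 ≤ a) (has : a < s) (hst : s ≤ t)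
    (hI : Icc a s ⊆ flowInterval E i) (hlt : (q s i).η (q s i).σ < (q s i).η 0) :
    costSelected E q t j < costNominal E q t j := by
  have hτ := hq.isHybridTimeDomain.isTimePartition_switchTimes h
  refine Finset.sum_lt_sum (fun k hk => ?_) ⟨i, Finset.mem_range.mpr (by omega), ?_⟩
  · have hk' : k ≤ j := Nat.lt_succ_iff.mp (Finset.mem_range.mp hk)
    exact hq.integral_η_σ_le (hτ.le_succ k hk') (hτ.Icc_subset hk')
  · have hsub : Icc a s ⊆ Icc (switchTimes E t j i) (switchTimes E t j (i + 1)) := by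
      rw [hτ.Icc_eq hij]
      exact subset_inter hI (Icc_subset_Icc ha hst)
    have hs := hsub (right_mem_Icc.mpr has.le)
    exact hq.integral_η_σ_lt (((hsub (left_mem_Icc.mpr has.le)).1.trans_lt has).trans_le hs.2)
      (hτ.Icc_subset hij) hs hlt

end IsSolution

end Scheme

end HybridMultiObserver

theorem theorem2 {nx nu nv nw ny nL N : ℕ}
    (hnx : 0 < nx) (hny : 0 < ny) (hnL : 0 < nL) (hN : 0 < N)
    (S : HybridMultiObserver.Scheme nx nu nv nw ny nL N)
    (α : ℝ) (Vf : HybridMultiObserver.Vec nx → ℝ)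
    (hnominal : S.NominalAssumption α Vf)
    (houtput : S.OutputAssumption Vf)
    (hcomplete : S.CompletenessAssumption)
    (hν : S.ν ≤ α)
    (u : ℝ → HybridMultiObserver.Vec nu) (v : ℝ → HybridMultiObserver.Vec nv)
    (w : ℝ → HybridMultiObserver.Vec nw)
    (hu : HybridMultiObserver.IsInput S.U u) (hv : HybridMultiObserver.IsInput S.V v)
    (hw : HybridMultiObserver.IsInput S.W w)
    (E : Set (ℝ × ℕ)) (q : ℝ → ℕ → HybridMultiObserver.State nx N)
    (hq : S.IsMaximalSolution u v w E q)
    (η₀ : ℝ) (hη₀ : ∀ k, (q 0 0).η k = η₀) :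
    (∀ t j, (t, j) ∈ E →
      HybridMultiObserver.costSelected E q t j ≤ HybridMultiObserver.costNominal E q t j) ∧
    (∀ tstar jstar, (tstar, jstar) ∈ E →
      (q tstar jstar).η (q tstar jstar).σ < (q tstar jstar).η 0 →
      ∃ jstar', jstar ≤ jstar' ∧ (tstar, jstar') ∈ E ∧
        ∀ t j, (t, j) ∈ E → tstar ≤ t → jstar' ≤ j →
          HybridMultiObserver.costSelected E q t j < HybridMultiObserver.costNominal E q t j) := by
  have hsol := hq.1
  refine ⟨fun t j h => hsol.costSelected_le h, fun tstar jstar h hlt => ?_⟩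
  obtain ⟨i, hij, a, ha, hat, hI, hlt'⟩ :=
    hsol.exists_flow_lt (fun k => by rw [hη₀, hη₀]) h hlt
  -- No further jump has to be awaited: the responsible interval has index `i ≤ jstar`, so `jstar`
  -- itself serves.
  exact ⟨jstar, le_rfl, h, fun t j hE ht hj =>
    hsol.costSelected_lt hE (hij.trans hj) ha hat ht hI hlt'⟩
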